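/- Let $K$ be a field of characteristic zero. For a finite connected simple graph $\Gamma$ with edge set $E(\Gamma)$, take one variable $x_e$ for each edge $e$, let $$F_\Gamma=\sum_{T}\prod_{e\in E(T)}x_e\in K[x_e : e\in E(\Gamma)],$$ where $T$ runs over the spanning trees of $\Gamma$, let $$H_\Gamma=\left(\frac{\partial^2F_\Gamma}{\partial x_i\,\partial x_j}\right)_{i,j\in E(\Gamma)}$$ be the Hessian matrix of $\Gamma$, and let $\tilde H_\Gamma$ be the value of $H_\Gamma$ at the point with $x_e=1$ for all $e$. Let $m,n\ge 1$ be integers with $m+n\ge 3$, and let $K_{m,n}$ be the complete bipartite graph with parts of sizes $m$ and $n$. Then $$\det\tilde H_{K_{m,n}}=(-1)^{mn-1}\,2^{(m-1)(n-1)}\,m^{(mn-m)(n-1)-1}\,n^{(mn-n)(m-1)-1}\,(m+n-1)(m+n-2).$$ Hence the Hessian $\det H_{K_{m,n}}$ is not the zero polynomial. -/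

import Mathlib

noncomputable section

/-- A set `T` of edges of `G` is (the edge set of) a spanning tree of `G` when the graph with all
the vertices of `G` and with edge set `T` is a tree. -/
def SimpleGraph.IsSpanningTreeEdges {V : Type*} (G : SimpleGraph V) (T : Finset G.edgeSet) : Prop :=
  (SimpleGraph.fromEdgeSet (Subtype.val '' (T : Set G.edgeSet))).IsTree

open Classical in
/-- The set of spanning trees of `G`, each given by its set of edges. -/
def SimpleGraph.spanningTrees {V : Type*} (G : SimpleGraph V) [Fintype G.edgeSet] :
    Finset (Finset G.edgeSet) :=
  {T | G.IsSpanningTreeEdges T}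

/-- The Kirchhoff polynomial of `G`: the sum over all spanning trees `T` of `G` of the product of
the variables of the edges of `T`; there is one variable for each edge of `G`. -/
def SimpleGraph.kirchhoffPolynomial (K : Type*) [CommRing K] {V : Type*} (G : SimpleGraph V)
    [Fintype G.edgeSet] : MvPolynomial G.edgeSet K :=
  ∑ T ∈ G.spanningTrees, ∏ e ∈ T, MvPolynomial.X e

/-- The Hessian matrix of `G`: the matrix of second partial derivatives of its Kirchhoff
polynomial. -/
def SimpleGraph.hessianMatrix (K : Type*) [CommRing K] {V : Type*} (G : SimpleGraph V)
    [Fintype G.edgeSet] : Matrix G.edgeSet G.edgeSet (MvPolynomial G.edgeSet K) :=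
  Matrix.of fun i j =>
    MvPolynomial.pderiv i (MvPolynomial.pderiv j (G.kirchhoffPolynomial K))

/-- The value of the Hessian matrix of `G` at the point all of whose coordinates are `1`. -/
def SimpleGraph.hessianMatrixAtOne (K : Type*) [CommRing K] {V : Type*} (G : SimpleGraph V)
    [Fintype G.edgeSet] : Matrix G.edgeSet G.edgeSet K :=
  (G.hessianMatrix K).map (MvPolynomial.eval fun _ => 1)

end

/-! Every monomial of F is squarefree, so for i ≠ j the entry of the Hessian at the all-ones point
is exactly the second difference F(1+e_i+e_j) − F(1+e_i) − F(1+e_j) + F(1). By the matrix-tree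
theorem, |V|² F(w) = det(L_w + J) with J all ones (`det_weightedLaplacian_add_one`). Raising the
weight of an edge by one adds x xᵀ to L_w, where x is the difference of the indicator vectors of its
endpoints. With A = L_1 + J and Y_ij = x_iᵀ A⁻¹ x_j, the rank-two determinant lemma gives |V|² H_ij
= det A · (Y_ii Y_jj − Y_ij Y_ji) (`card_sq_mul_hessianMatrixAtOne`).

For K_{m,n}, A is block diagonal with blocks nI + J and mI + J, so for edges (i,j), (k,l) one finds
Y = (m δ_ik + n δ_jl − 1)/(mn). Hence the Hessian is a scalar times a combination of I⊗I, I⊗J, J⊗I,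
J⊗J. The eigenvalues of that combination are −2mn, −m²n, −n²m and mn(m+n−1)(m+n−2), with
multiplicities (m−1)(n−1), m−1, n−1 and 1 (`det_kronecker_one_ones`). -/

open Finset Matrix

/-! ### Spanning trees as parent maps towards a root -/

namespace SimpleGraph

/-- A parent map of a spanning tree of `G` rooted at `r`: each vertex other than `r` is sent to a
neighbour, and iteration leads to `r`, as witnessed by a height function. -/
structure IsParentMap {V : Type*} (G : SimpleGraph V) (r : V) (f : V → V) : Prop where
  map_root : f r = r
  adj : ∀ v, v ≠ r → G.Adj v (f v)
  exists_height : ∃ h : V → ℕ, ∀ v, v ≠ r → h (f v) < h v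

open Classical in
/-- The set of edges joining the vertices other than `r` to their images under `f`. -/
noncomputable def parentEdges {V : Type*} (G : SimpleGraph V) [Fintype G.edgeSet] (r : V) (f : V → V) :
    Finset G.edgeSet :=
  {e | ∃ v, v ≠ r ∧ e.1 = s(v, f v)}

variable {V : Type*} {G : SimpleGraph V} {r : V}

lemma mem_parentEdges [Fintype G.edgeSet] {f : V → V} {e : G.edgeSet} :
    e ∈ G.parentEdges r f ↔ ∃ v, v ≠ r ∧ e.1 = s(v, f v) := by
  classical
  simp [parentEdges]

/-- If one edge came from two vertices, each would be the parent of the other, and the height would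
drop both ways. So v ↦ {v, f v} is injective off the root. -/
lemma IsParentMap.eq_of_edge_eq {f : V → V} (hf : G.IsParentMap r f) {u v : V} (hu : u ≠ r)
    (hv : v ≠ r) (h : s(u, f u) = s(v, f v)) : u = v := by
  obtain ⟨ht, hh⟩ := hf.exists_height
  have h1 := hh u hu
  have h2 := hh v hv
  rcases Sym2.eq_iff.1 h with ⟨h, -⟩ | ⟨h3, h4⟩
  · exact h
  · rw [h4] at h1
    rw [← h3] at h2
    omega

lemma IsParentMap.prod_parentEdges [Fintype V] [Fintype G.edgeSet] [DecidableEq V] {f : V → V}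
    (hf : G.IsParentMap r f) {M : Type*} [CommMonoid M] (w : G.edgeSet → M) (c : V → M)
    (hc : ∀ v (hv : v ≠ r), c v = w ⟨s(v, f v), hf.adj v hv⟩) :
    ∏ e ∈ G.parentEdges r f, w e = ∏ v ∈ univ.erase r, c v := by
  symm
  refine Finset.prod_bij (fun v hv => ⟨s(v, f v), hf.adj v (Finset.ne_of_mem_erase hv)⟩) ?_ ?_ ?_ ?_
  · exact fun v hv => mem_parentEdges.2 ⟨v, Finset.ne_of_mem_erase hv, rfl⟩
  · intro u hu v hv h
    exact hf.eq_of_edge_eq (Finset.ne_of_mem_erase hu) (Finset.ne_of_mem_erase hv)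
      (congrArg Subtype.val h)
  · intro e he
    obtain ⟨v, hv, h⟩ := mem_parentEdges.1 he
    exact ⟨v, by simpa using hv, Subtype.ext h.symm⟩
  · exact fun v hv => hc v (Finset.ne_of_mem_erase hv)

lemma IsParentMap.card_parentEdges [Fintype V] [Fintype G.edgeSet] {f : V → V}
    (hf : G.IsParentMap r f) : #(G.parentEdges r f) + 1 = Fintype.card V := by
  classical
  have h : #(G.parentEdges r f) = #(univ.erase r) := by
    symm
    refine Finset.card_bij
      (fun v hv => ⟨s(v, f v), hf.adj v (Finset.ne_of_mem_erase hv)⟩) ?_ ?_ ?_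
    · exact fun v hv => mem_parentEdges.2 ⟨v, Finset.ne_of_mem_erase hv, rfl⟩
    · intro u hu v hv h
      exact hf.eq_of_edge_eq (Finset.ne_of_mem_erase hu) (Finset.ne_of_mem_erase hv)
        (congrArg Subtype.val h)
    · intro e he
      obtain ⟨v, hv, h⟩ := mem_parentEdges.1 he
      exact ⟨v, by simpa using hv, Subtype.ext h.symm⟩
  rw [h, Finset.card_erase_add_one (Finset.mem_univ r), Finset.card_univ]

lemma edgeSet_fromEdgeSet_image (T : Set G.edgeSet) :
    (fromEdgeSet (Subtype.val '' T)).edgeSet = Subtype.val '' T := by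
  rw [edgeSet_fromEdgeSet]
  ext e
  simp only [Set.mem_sdiff, Set.mem_image, Subtype.exists, exists_and_right, exists_eq_right]
  refine ⟨fun h => h.1, fun h => ⟨h, ?_⟩⟩
  obtain ⟨he, -⟩ := h
  exact G.not_isDiag_of_mem_edgeSet he

lemma natCard_edgeSet_fromEdgeSet_image (T : Finset G.edgeSet) :
    Nat.card (fromEdgeSet (Subtype.val '' (T : Set G.edgeSet))).edgeSet = #T := by
  rw [edgeSet_fromEdgeSet_image, Nat.card_image_of_injective Subtype.val_injective]
  simp

lemma IsParentMap.connected [Fintype G.edgeSet] {f : V → V} (hf : G.IsParentMap r f) :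
    (fromEdgeSet (Subtype.val '' (G.parentEdges r f : Set G.edgeSet))).Connected := by
  obtain ⟨h, hh⟩ := hf.exists_height
  refine (connected_iff_exists_forall_reachable _).2 ⟨r, ?_⟩
  suffices H : ∀ k v, h v = k →
      (fromEdgeSet (Subtype.val '' (G.parentEdges r f : Set G.edgeSet))).Reachable r v from
    fun v => H _ v rfl
  intro k
  induction k using Nat.strong_induction_on with
  | _ k ih =>
    intro v hk
    by_cases hv : v = r
    · rw [hv]
    · refine (ih _ (hk ▸ hh v hv) (f v) rfl).trans (Adj.reachable ?_)
      rw [fromEdgeSet_adj]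
      refine ⟨⟨⟨s(v, f v), hf.adj v hv⟩, ?_, Sym2.eq_swap⟩, (hf.adj v hv).ne'⟩
      exact Finset.mem_coe.2 (mem_parentEdges.2 ⟨v, hv, rfl⟩)

lemma IsParentMap.isSpanningTreeEdges [Fintype V] [Fintype G.edgeSet] {f : V → V}
    (hf : G.IsParentMap r f) : G.IsSpanningTreeEdges (G.parentEdges r f) := by
  refine isTree_iff_connected_and_card.2 ⟨hf.connected, ?_⟩
  rw [natCard_edgeSet_fromEdgeSet_image, hf.card_parentEdges, Nat.card_eq_fintype_card]

lemma IsSpanningTreeEdges.card_add_one [Fintype V] {T : Finset G.edgeSet}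
    (hT : G.IsSpanningTreeEdges T) : #T + 1 = Fintype.card V := by
  rw [← natCard_edgeSet_fromEdgeSet_image, ← Nat.card_eq_fintype_card]
  exact (isTree_iff_connected_and_card.1 hT).2

lemma IsParentMap.parentEdges_injective [Fintype G.edgeSet] {f g : V → V}
    (hf : G.IsParentMap r f) (hg : G.IsParentMap r g)
    (h : G.parentEdges r f = G.parentEdges r g) : f = g := by
  obtain ⟨ht, hh⟩ := hf.exists_height
  suffices H : ∀ k v, ht v = k → f v = g v from funext fun v => H _ v rfl
  intro k
  induction k using Nat.strong_induction_on with
  | _ k ih =>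
    intro v hk
    by_cases hv : v = r
    · rw [hv, hf.map_root, hg.map_root]
    have he : (⟨s(v, f v), hf.adj v hv⟩ : G.edgeSet) ∈ G.parentEdges r g :=
      h ▸ mem_parentEdges.2 ⟨v, hv, rfl⟩
    obtain ⟨u, hu, huv⟩ := mem_parentEdges.1 he
    rcases Sym2.eq_iff.1 huv with ⟨h1, h2⟩ | ⟨h1, h2⟩
    · rw [h2, h1]
    -- Here g (f v) = v while induction gives f (f v) = g (f v), so f (f v) = v: a 2-cycle, which
    -- the height forbids.
    · have h3 := ih _ (hk ▸ hh v hv) (f v) rfl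
      have h4 := hh v hv
      have h5 := hh (f v) (h2 ▸ hu)
      rw [h3, h2, ← h1, ← h2] at h5
      omega

lemma Connected.exists_adj_dist_lt (hG : G.Connected) {v : V} (hv : v ≠ r) :
    ∃ u, G.Adj v u ∧ G.dist u r < G.dist v r := by
  obtain ⟨p, hp⟩ := hG.exists_walk_length_eq_dist v r
  cases p with
  | nil => exact absurd rfl hv
  | cons hadj q =>
    refine ⟨_, hadj, ?_⟩
    rw [← hp, Walk.length_cons]
    exact Nat.lt_succ_of_le (dist_le q)

/-- Send each vertex to a neighbour in T closer to r. The resulting edges lie in T and number |V| −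
1 = |T|, so they are all of T. -/
lemma IsSpanningTreeEdges.exists_isParentMap [Fintype V] [Fintype G.edgeSet] (r : V)
    {T : Finset G.edgeSet} (hT : G.IsSpanningTreeEdges T) :
    ∃ f, G.IsParentMap r f ∧ G.parentEdges r f = T := by
  classical
  have hc := (isTree_iff_connected_and_card.1 hT).1
  choose! g hg using fun v (hv : v ≠ r) => hc.exists_adj_dist_lt hv
  have hmem : ∀ v, v ≠ r → ∃ e ∈ T, e.1 = s(v, g v) := fun v hv => by
    have h := (hg v hv).1
    rw [fromEdgeSet_adj] at h
    obtain ⟨e, he, h⟩ := h.1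
    exact ⟨e, he, h⟩
  have hf : G.IsParentMap r (Function.update g r r) := by
    refine ⟨Function.update_self .., fun v hv => ?_,
      fun v => (fromEdgeSet (Subtype.val '' (T : Set G.edgeSet))).dist v r, fun v hv => ?_⟩
    · obtain ⟨e, -, h⟩ := hmem v hv
      rw [Function.update_of_ne hv, ← mem_edgeSet, ← h]
      exact e.2
    · rw [Function.update_of_ne hv]
      exact (hg v hv).2
  refine ⟨_, hf, Finset.eq_of_subset_of_card_le (fun e he => ?_) ?_⟩
  · obtain ⟨v, hv, h⟩ := mem_parentEdges.1 he
    rw [Function.update_of_ne hv] at h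
    obtain ⟨e', he', h'⟩ := hmem v hv
    rwa [Subtype.ext (h.trans h'.symm)]
  · have h1 := hf.card_parentEdges
    have h2 := hT.card_add_one
    omega

/-! ### The weighted matrix-tree theorem -/

/-- The rows of the identity minus the parent map `f`, with the root row left as in the identity. -/
def parentMatrix (K : Type*) [Ring K] [DecidableEq V] (r : V) (f : V → V) : Matrix V V K :=
  Matrix.of fun v => if v = r then Pi.single r 1 else Pi.single v 1 - Pi.single (f v) 1

/-- Ordered by height the matrix is block triangular, and its diagonal blocks are identities because
f v is strictly lower than v. -/
lemma det_parentMatrix_of_height {K : Type*} [CommRing K] [Fintype V] [DecidableEq V] {f : V → V}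
    (h : V → ℕ) (hh : ∀ v, v ≠ r → h (f v) < h v) : (parentMatrix K r f).det = 1 := by
  have hT : (parentMatrix K r f).BlockTriangular (fun v => OrderDual.toDual (h v)) := by
    intro v u hvu
    have hlt : h v < h u := hvu
    have hne : v ≠ u := by rintro rfl; exact lt_irrefl _ hlt
    simp only [parentMatrix, Matrix.of_apply]
    split_ifs with hv
    · subst hv
      exact Pi.single_eq_of_ne hne.symm _
    · have h2 : u ≠ f v := by
        rintro rfl
        exact absurd (hh v hv) (by omega)
      simp [Pi.single_eq_of_ne hne.symm, Pi.single_eq_of_ne h2]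
  rw [hT.det]
  refine Finset.prod_eq_one fun a _ => ?_
  convert Matrix.det_one (n := {v // OrderDual.toDual (h v) = a}) (R := K)
  ext ⟨v, hv⟩ ⟨u, hu⟩
  have hvu : h v = h u := OrderDual.toDual.injective (hv.trans hu.symm)
  simp only [parentMatrix, Matrix.toSquareBlock_def, Matrix.of_apply, Matrix.one_apply,
    Subtype.mk.injEq]
  split_ifs with h1 h2 h2
  · subst h1 h2; simp
  · subst h1; exact Pi.single_eq_of_ne (Ne.symm h2) _
  · subst h2
    have h3 : v ≠ f v := fun h3 => absurd (hh v h1) (by rw [← h3]; exact lt_irrefl _)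
    simp [Pi.single_eq_of_ne h3]
  · have h3 : u ≠ f v := fun h3 => absurd (hh v h1) (by rw [← h3, hvu]; exact lt_irrefl _)
    simp [Pi.single_eq_of_ne (Ne.symm h2), Pi.single_eq_of_ne h3]

/-- If every orbit met r, the hitting time would be a height. Otherwise the indicator of the
vertices whose orbit misses r is a nonzero kernel vector. -/
lemma det_parentMatrix_of_not_height {K : Type*} [CommRing K] [IsDomain K] [Fintype V]
    [DecidableEq V] {f : V → V}
    (hf : ¬ ∃ h : V → ℕ, ∀ v, v ≠ r → h (f v) < h v) : (parentMatrix K r f).det = 0 := by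
  classical
  have hex : ∃ v, ∀ k, f^[k] v ≠ r := by
    by_contra! hcon
    refine hf ⟨fun v => Nat.find (hcon v), fun v hv => ?_⟩
    have h1 := Nat.find_spec (hcon v)
    obtain ⟨k, hk⟩ : ∃ k, Nat.find (hcon v) = k + 1 :=
      Nat.exists_eq_succ_of_ne_zero fun h0 => hv (by rwa [h0] at h1)
    rw [hk] at h1
    beta_reduce
    rw [hk]
    exact Nat.lt_succ_of_le (Nat.find_min' _ h1)
  obtain ⟨v₀, hv₀⟩ := hex
  refine Matrix.exists_mulVec_eq_zero_iff.1 ⟨fun v => if ∀ k, f^[k] v ≠ r then 1 else 0, ?_, ?_⟩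
  · exact fun h0 => by simpa [hv₀] using congrFun h0 v₀
  · have hroot : ¬ ∀ k, f^[k] r ≠ r := fun h => h 0 rfl
    have hstep : ∀ v, v ≠ r → ((∀ k, f^[k] (f v) ≠ r) ↔ ∀ k, f^[k] v ≠ r) := fun v hv =>
      ⟨fun h k => by
        cases k with
        | zero => exact hv
        | succ k => exact h k, fun h k => h (k + 1)⟩
    ext v
    simp only [Matrix.mulVec, parentMatrix, Matrix.of_apply, Pi.zero_apply]
    split_ifs with hv
    · rw [single_one_dotProduct, if_neg hroot]
    · rw [sub_dotProduct, single_one_dotProduct, single_one_dotProduct]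
      simp only [hstep v hv, sub_self]

open Classical in
/-- The weight of the ordered pair `(v, u)`: the weight of the edge `vu`, or zero if `v` and `u`
are not adjacent. -/
noncomputable def adjWeight {K : Type*} [Zero K] (G : SimpleGraph V) (w : G.edgeSet → K) (v u : V) : K :=
  if h : G.Adj v u then w ⟨s(v, u), h⟩ else 0

/-- The weighted Laplacian of `G`. -/
noncomputable def weightedLaplacian {K : Type*} [Ring K] (G : SimpleGraph V) [Fintype V] [DecidableEq V]
    (w : G.edgeSet → K) : Matrix V V K :=
  Matrix.of fun v => ∑ u, G.adjWeight w v u • (Pi.single v 1 - Pi.single u 1)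

/-- Expanding by multilinearity in the rows gives one term per map f : V → V; exactly the parent
maps survive, each with determinant 1. -/
lemma det_updateRow_weightedLaplacian_eq_sum {K : Type*} [CommRing K] [IsDomain K] [Fintype V]
    [DecidableEq V] [Fintype G.edgeSet] (w : G.edgeSet → K) (r : V) :
    ((G.weightedLaplacian w).updateRow r (Pi.single r 1)).det =
      ∑ T ∈ G.spanningTrees, ∏ e ∈ T, w e := by
  classical
  -- Row r is also written as a sum over u, with only u = r contributing; this forces f r = r in the
  -- expansion.
  have hrows : (G.weightedLaplacian w).updateRow r (Pi.single r 1) =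
      fun v => ∑ u, (if v = r then (if u = r then 1 else 0) else G.adjWeight w v u) •
        (if v = r then Pi.single r 1 else Pi.single v 1 - Pi.single u 1 : V → K) := by
    funext v
    by_cases hv : v = r
    · subst hv
      simp
    · simp only [Matrix.updateRow_ne hv, if_neg hv]
      rfl
  rw [hrows]
  change Matrix.detRowAlternating.toMultilinearMap _ = _
  rw [MultilinearMap.map_sum]
  simp_rw [MultilinearMap.map_smul_univ]
  have hdet : ∀ f : V → V, (Matrix.detRowAlternating.toMultilinearMap
      fun v => (if v = r then Pi.single r 1 else Pi.single v 1 - Pi.single (f v) 1 : V → K)) =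
      (parentMatrix K r f).det := fun f => rfl
  simp_rw [hdet, smul_eq_mul]
  rw [← Finset.sum_subset (Finset.subset_univ {f : V → V | G.IsParentMap r f})]
  · refine Finset.sum_bij (fun f _ => G.parentEdges r f) ?_ ?_ ?_ ?_
    · intro f hf
      simpa [spanningTrees] using (Finset.mem_filter.1 hf).2.isSpanningTreeEdges
    · intro f hf g hg h
      exact (Finset.mem_filter.1 hf).2.parentEdges_injective (Finset.mem_filter.1 hg).2 h
    · intro T hT
      obtain ⟨f, hf, h⟩ := ((Finset.mem_filter.1 hT).2).exists_isParentMap r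
      exact ⟨f, Finset.mem_filter.2 ⟨Finset.mem_univ _, hf⟩, h⟩
    · intro f hf
      have hf := (Finset.mem_filter.1 hf).2
      obtain ⟨h, hh⟩ := hf.exists_height
      rw [det_parentMatrix_of_height h hh, mul_one,
        ← Finset.mul_prod_erase _ _ (Finset.mem_univ r), if_pos rfl, if_pos hf.map_root, one_mul]
      symm
      refine hf.prod_parentEdges w _ fun v hv => ?_
      rw [if_neg hv, adjWeight, dif_pos (hf.adj v hv)]
  · intro f _ hf
    by_cases hr : f r = r
    · by_cases hadj : ∀ v, v ≠ r → G.Adj v (f v)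
      · rw [det_parentMatrix_of_not_height, mul_zero]
        exact fun hh => hf (Finset.mem_filter.2 ⟨Finset.mem_univ _, hr, hadj, hh⟩)
      · push Not at hadj
        obtain ⟨v, hv, hadj⟩ := hadj
        rw [Finset.prod_eq_zero (Finset.mem_univ v), zero_mul]
        rw [if_neg hv, adjWeight, dif_neg hadj]
    · rw [Finset.prod_eq_zero (Finset.mem_univ r), zero_mul]
      rw [if_pos rfl, if_neg hr]

lemma adjWeight_comm {K : Type*} [Zero K] (w : G.edgeSet → K) (v u : V) :
    G.adjWeight w v u = G.adjWeight w u v := by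
  classical
  unfold adjWeight
  by_cases h : G.Adj v u
  · rw [dif_pos h, dif_pos h.symm]
    congr 2
    exact Sym2.eq_swap
  · rw [dif_neg h, dif_neg fun h' => h h'.symm]

lemma weightedLaplacian_apply {K : Type*} [Ring K] [Fintype V] [DecidableEq V]
    (w : G.edgeSet → K) (v u : V) :
    G.weightedLaplacian w v u =
      (if v = u then ∑ x, G.adjWeight w v x else 0) - G.adjWeight w v u := by
  simp only [weightedLaplacian, Matrix.of_apply, Finset.sum_apply, Pi.smul_apply, Pi.sub_apply,
    Pi.single_apply, smul_eq_mul, mul_sub, mul_ite, mul_one, mul_zero, Finset.sum_sub_distrib,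
    Finset.sum_ite_eq, Finset.mem_univ, if_true]
  congr 1
  by_cases h : v = u
  · simp [h]
  · simp [h, Ne.symm h]

lemma sum_weightedLaplacian_row {K : Type*} [Ring K] [Fintype V] [DecidableEq V]
    (w : G.edgeSet → K) (v : V) : ∑ u, G.weightedLaplacian w v u = 0 := by
  simp [weightedLaplacian_apply, Finset.sum_sub_distrib]

lemma sum_weightedLaplacian_col {K : Type*} [Ring K] [Fintype V] [DecidableEq V]
    (w : G.edgeSet → K) (u : V) : ∑ v, G.weightedLaplacian w v u = 0 := by
  simp only [weightedLaplacian_apply, Finset.sum_sub_distrib, Finset.sum_ite_eq',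
    Finset.mem_univ, if_true]
  rw [sub_eq_zero]
  exact Finset.sum_congr rfl fun x _ => adjWeight_comm w u x

/-- The weighted matrix-tree theorem, in the form which does not single out a vertex. -/
theorem det_weightedLaplacian_add_one {K : Type*} [CommRing K] [IsDomain K] [Fintype V]
    [DecidableEq V] [Nonempty V] [Fintype G.edgeSet] (w : G.edgeSet → K) :
    (G.weightedLaplacian w + Matrix.of fun _ _ => 1).det =
      (Fintype.card V : K) ^ 2 * ∑ T ∈ G.spanningTrees, ∏ e ∈ T, w e := by
  obtain ⟨r⟩ := ‹Nonempty V›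
  set L := G.weightedLaplacian w with hL
  set N : K := (Fintype.card V : K) with hN
  -- The columns of L sum to zero, so adding all rows into row r makes it N times the all-ones row,
  -- which then clears J from the other rows.
  have h1 : (L + Matrix.of fun _ _ => 1).det = N * (L.updateRow r fun _ => 1).det := by
    have h := Matrix.det_updateRow_sum (L + Matrix.of fun _ _ => 1) r fun _ => 1
    have hs : ∑ k, (1 : K) • (L + Matrix.of fun _ _ => 1 : Matrix V V K) k = N • fun _ => 1 := by
      ext u
      refine (Finset.sum_apply u _ _).trans ?_
      change ∑ v, (1 : K) * (L v u + 1) = N * 1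
      simp [Finset.sum_add_distrib, hL, sum_weightedLaplacian_col, hN]
    rw [hs, Matrix.det_updateRow_smul, one_smul] at h
    rw [← h]
    congr 1
    refine Matrix.det_eq_of_forall_row_eq_smul_add_const (fun v => if v = r then 0 else 1) r
      (if_pos rfl) fun v u => ?_
    by_cases hv : v = r
    · subst hv; simp
    · simp [hv]
  have h2 : (L.updateRow r fun _ => 1).det = N * (L.updateRow r (Pi.single r 1)).det := by
    -- With row r equal to 1 − N e_r, every row sums to zero, so the all-ones vector is in the
    -- kernel.
    have h0 : (L.updateRow r ((fun _ => 1) + (-N) • Pi.single r 1)).det = 0 := by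
      refine Matrix.exists_mulVec_eq_zero_iff.1 ⟨fun _ => 1, fun h => ?_, ?_⟩
      · simpa using congrFun h r
      · ext v
        by_cases hv : v = r
        · subst hv
          simp [Matrix.mulVec, dotProduct, Finset.sum_add_distrib, hN, Pi.single_apply]
        · simp [Matrix.mulVec, dotProduct, Matrix.updateRow_ne hv, hL, sum_weightedLaplacian_row]
    rw [Matrix.det_updateRow_add, Matrix.det_updateRow_smul] at h0
    linear_combination h0
  rw [h1, h2, det_updateRow_weightedLaplacian_eq_sum]
  ring

end SimpleGraph

/-! ### Values and derivatives of squarefree monomials -/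

lemma Finset.prod_one_add_single {ι R : Type*} [CommRing R] [DecidableEq ι] (T : Finset ι)
    (i : ι) : ∏ e ∈ T, (1 + Pi.single i 1 : ι → R) e = 1 + if i ∈ T then 1 else 0 := by
  have h : ∀ e ∈ T, (1 + Pi.single i 1 : ι → R) e = if e = i then 2 else 1 := fun e _ => by
    by_cases he : e = i
    · subst he; simp; norm_num
    · simp [he]
  rw [Finset.prod_congr rfl h, Finset.prod_ite_eq']
  split_ifs <;> norm_num

lemma Finset.prod_one_add_single_add_single {ι R : Type*} [CommRing R] [DecidableEq ι]
    (T : Finset ι) {i j : ι} (hij : i ≠ j) :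
    ∏ e ∈ T, (1 + Pi.single i 1 + Pi.single j 1 : ι → R) e =
      (1 + if i ∈ T then 1 else 0) * (1 + if j ∈ T then 1 else 0) := by
  rw [← prod_one_add_single, ← prod_one_add_single, ← Finset.prod_mul_distrib]
  refine Finset.prod_congr rfl fun e _ => ?_
  by_cases hi : e = i
  · subst hi; simp [hij]
  · simp [hi]

lemma MvPolynomial.pderiv_prod_X {σ R : Type*} [CommSemiring R] [DecidableEq σ] (T : Finset σ)
    (i : σ) : pderiv i (∏ e ∈ T, (X e : MvPolynomial σ R)) =
      if i ∈ T then ∏ e ∈ T.erase i, X e else 0 := by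
  induction T using Finset.induction_on with
  | empty => simp
  | insert a T ha ih =>
    rw [Finset.prod_insert ha, Derivation.leibniz, ih, pderiv_X]
    by_cases h : i = a
    · subst h
      simp [ha]
    · have h' : a ≠ i := Ne.symm h
      by_cases hi : i ∈ T
      · have h2 : a ∉ T.erase i := fun h2 => ha (Finset.mem_of_mem_erase h2)
        simp [h, hi, Finset.erase_insert_of_ne h', Finset.prod_insert h2]
      · simp [h, hi]

/-! ### Determinants of low-rank updates and of Kronecker combinations -/

namespace Matrix

lemma det_add_vecMulVec_add_vecMulVec {V K : Type*} [Field K] [Fintype V] [DecidableEq V]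
    {A : Matrix V V K} (hA : IsUnit A.det) (x y : V → K) :
    (A + vecMulVec x x + vecMulVec y y).det =
      A.det * ((1 + x ⬝ᵥ A⁻¹ *ᵥ x) * (1 + y ⬝ᵥ A⁻¹ *ᵥ y) -
        (x ⬝ᵥ A⁻¹ *ᵥ y) * (y ⬝ᵥ A⁻¹ *ᵥ x)) := by
  have h : A + vecMulVec x x + vecMulVec y y =
      A + (Matrix.of ![x, y])ᵀ * Matrix.of ![x, y] := by
    ext u v
    simp [Matrix.mul_apply, vecMulVec_apply, add_assoc]
  have hdot : ∀ (M : Matrix (Fin 2) V K) k l, (M * A⁻¹ * Mᵀ) k l = M k ⬝ᵥ A⁻¹ *ᵥ M l :=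
    fun M k l => by
      rw [Matrix.mul_assoc]
      rfl
  rw [h, Matrix.det_add_mul _ _ hA, Matrix.det_fin_two]
  simp only [Matrix.add_apply, hdot]
  change _ * ((1 + x ⬝ᵥ A⁻¹ *ᵥ x) * (1 + y ⬝ᵥ A⁻¹ *ᵥ y) -
    (0 + x ⬝ᵥ A⁻¹ *ᵥ y) * (0 + y ⬝ᵥ A⁻¹ *ᵥ x)) = _
  rw [zero_add, zero_add]

/-- The determinant of a linear combination of the identity and the all-ones matrix. -/
lemma det_smul_one_add_smul_ones {ι K : Type*} [Field K] [Fintype ι] [DecidableEq ι] [Nonempty ι]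
    {a : K} (ha : a ≠ 0) (b : K) :
    (a • (1 : Matrix ι ι K) + b • Matrix.of fun _ _ => 1).det =
      a ^ (Fintype.card ι - 1) * (a + Fintype.card ι * b) := by
  have h : a • (1 : Matrix ι ι K) + b • Matrix.of (fun _ _ => 1) =
      a • (1 + Matrix.replicateCol Unit (fun _ : ι => b / a) *
        Matrix.replicateRow Unit fun _ : ι => (1 : K)) := by
    ext i j
    simp [Matrix.mul_apply, mul_add, mul_div_cancel₀ _ ha]
  rw [h, Matrix.det_smul, Matrix.det_one_add_replicateCol_mul_replicateRow]
  obtain ⟨k, hk⟩ : ∃ k, Fintype.card ι = k + 1 :=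
    Nat.exists_eq_succ_of_ne_zero Fintype.card_ne_zero
  simp only [dotProduct, one_mul, Finset.sum_const, Finset.card_univ, hk, nsmul_eq_mul,
    Nat.add_sub_cancel]
  field_simp
  ring

open scoped Kronecker in
/-- The determinant of a linear combination of the four Kronecker products of identity and
all-ones matrices. -/
lemma det_kronecker_one_ones {α β K : Type*} [Field K] [Fintype α] [DecidableEq α] [Nonempty α]
    [Fintype β] [DecidableEq β] [Nonempty β] {a b c d : K} (ha : a ≠ 0)
    (hb : a + Fintype.card β * b ≠ 0) (hc : a + Fintype.card α * c ≠ 0) :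
    (Matrix.of fun p q : α × β => (if p = q then a else 0) + (if p.1 = q.1 then b else 0) +
      (if p.2 = q.2 then c else 0) + d).det =
    a ^ ((Fintype.card α - 1) * (Fintype.card β - 1)) *
      (a + Fintype.card β * b) ^ (Fintype.card α - 1) *
      (a + Fintype.card α * c) ^ (Fintype.card β - 1) *
      (a + Fintype.card β * b + Fintype.card α * c + Fintype.card α * Fintype.card β * d) := by
  set J : Matrix β β K := Matrix.of fun _ _ => 1 with hJ
  set P : Matrix β β K := a • 1 + b • J with hP
  set Q : Matrix β β K := c • 1 + d • J with hQ
  have hPdet := det_smul_one_add_smul_ones (ι := β) ha b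
  rw [← hJ, ← hP] at hPdet
  have hPu : IsUnit P.det := by
    rw [hPdet]
    exact (mul_ne_zero (pow_ne_zero _ ha) hb).isUnit
  have hdet : ((1 : Matrix α α K) ⊗ₖ P).det = P.det ^ Fintype.card α := by
    rw [Matrix.det_kronecker, Matrix.det_one, one_pow, one_mul]
  have hinv : ((1 : Matrix α α K) ⊗ₖ P)⁻¹ = 1 ⊗ₖ P⁻¹ := by
    rw [Matrix.inv_kronecker, inv_one]
  -- The terms not involving the α-identity are J ⊗ Q = U W, which factors through β; the
  -- determinant lemma thus reduces to size |β|.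
  let U : Matrix (α × β) β K := Matrix.of fun p l => if p.2 = l then 1 else 0
  let W : Matrix β (α × β) K := Matrix.of fun l q => Q l q.2
  have hM : (Matrix.of fun p q : α × β => (if p = q then a else 0) + (if p.1 = q.1 then b else 0) +
      (if p.2 = q.2 then c else 0) + d) = (1 : Matrix α α K) ⊗ₖ P + U * W := by
    ext ⟨i, j⟩ ⟨k, l⟩
    simp only [U, W, hP, hQ, hJ, Matrix.mul_apply, Matrix.of_apply, Matrix.add_apply,
      Matrix.kroneckerMap_apply, Matrix.smul_apply, Matrix.one_apply, smul_eq_mul, Prod.mk.injEq]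
    by_cases h1 : i = k <;> by_cases h2 : j = l <;> (simp [h1, h2]; try ring)
  have hW : W * ((1 : Matrix α α K) ⊗ₖ P⁻¹) * U = (Fintype.card α : K) • (Q * P⁻¹) := by
    ext j l
    simp [U, W, Matrix.mul_apply, Fintype.sum_prod_type, Matrix.one_apply, ite_mul]
  have hPQ : P + (Fintype.card α : K) • Q =
      (a + Fintype.card α * c) • 1 + (b + Fintype.card α * d) • J := by
    ext j l
    simp only [hP, hQ, Matrix.add_apply, Matrix.smul_apply, smul_eq_mul]
    ring
  -- One of the |α| factors det P absorbs P⁻¹, leaving another combination of I and J.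
  have hfin : P.det * (1 + (Fintype.card α : K) • (Q * P⁻¹)).det =
      (P + (Fintype.card α : K) • Q).det := by
    rw [mul_comm, ← Matrix.det_mul, add_mul, one_mul, smul_mul_assoc, Matrix.mul_assoc,
      Matrix.nonsing_inv_mul _ hPu, Matrix.mul_one]
  rw [hM, Matrix.det_add_mul _ _ (by rw [hdet]; exact hPu.pow _), hinv, hW, hdet]
  obtain ⟨k, hk⟩ : ∃ k, Fintype.card α = k + 1 :=
    Nat.exists_eq_succ_of_ne_zero Fintype.card_ne_zero
  have hlast := hfin.trans (congrArg det hPQ)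
  rw [det_smul_one_add_smul_ones hc] at hlast
  rw [hk] at hlast ⊢
  rw [pow_succ, mul_assoc, hlast, hPdet]
  simp only [Nat.add_sub_cancel]
  rw [mul_pow, ← pow_mul, mul_comm k]
  ring

end Matrix

/-! ### Hessian entries as second differences and transfer currents -/

namespace SimpleGraph

variable {V : Type*} {G : SimpleGraph V}

lemma hessianMatrixAtOne_eq_sum {K : Type*} [CommRing K] [Fintype G.edgeSet]
    [DecidableEq G.edgeSet] (i j : G.edgeSet) :
    G.hessianMatrixAtOne K i j =
      ∑ T ∈ G.spanningTrees, if i ≠ j ∧ i ∈ T ∧ j ∈ T then 1 else 0 := by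
  simp only [hessianMatrixAtOne, hessianMatrix, kirchhoffPolynomial, Matrix.map_apply,
    Matrix.of_apply, map_sum]
  refine Finset.sum_congr rfl fun T _ => ?_
  rw [MvPolynomial.pderiv_prod_X]
  by_cases hj : j ∈ T
  · rw [if_pos hj, MvPolynomial.pderiv_prod_X]
    by_cases hi : i ∈ T.erase j
    · have h := Finset.mem_erase.1 hi
      rw [if_pos hi, if_pos ⟨h.1, h.2, hj⟩]
      simp
    · rw [if_neg hi, if_neg fun h => hi (Finset.mem_erase.2 ⟨h.1, h.2.1⟩), map_zero]
  · rw [if_neg hj, if_neg fun h => hj h.2.2, map_zero, map_zero]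

lemma hessianMatrixAtOne_self {K : Type*} [CommRing K] [Fintype G.edgeSet] (i : G.edgeSet) :
    G.hessianMatrixAtOne K i i = 0 := by
  classical
  simp [hessianMatrixAtOne_eq_sum]

/-- For a squarefree monomial the mixed second difference with unit steps equals the mixed
derivative. -/
lemma hessianMatrixAtOne_of_ne {K : Type*} [CommRing K] [Fintype G.edgeSet]
    [DecidableEq G.edgeSet] {i j : G.edgeSet} (hij : i ≠ j) :
    G.hessianMatrixAtOne K i j =
      ∑ T ∈ G.spanningTrees, ∏ e ∈ T, (1 + Pi.single i 1 + Pi.single j 1 : G.edgeSet → K) e -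
      ∑ T ∈ G.spanningTrees, ∏ e ∈ T, (1 + Pi.single i 1 : G.edgeSet → K) e -
      ∑ T ∈ G.spanningTrees, ∏ e ∈ T, (1 + Pi.single j 1 : G.edgeSet → K) e +
      ∑ T ∈ G.spanningTrees, ∏ e ∈ T, (1 : G.edgeSet → K) e := by
  rw [hessianMatrixAtOne_eq_sum, ← Finset.sum_sub_distrib, ← Finset.sum_sub_distrib,
    ← Finset.sum_add_distrib]
  refine Finset.sum_congr rfl fun T _ => ?_
  rw [Finset.prod_one_add_single_add_single _ hij, Finset.prod_one_add_single,
    Finset.prod_one_add_single]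
  simp only [hij, ne_eq, not_false_eq_true, true_and, Pi.one_apply, Finset.prod_const_one]
  by_cases hi : i ∈ T <;> by_cases hj : j ∈ T <;> (simp [hi, hj]; try ring)

lemma adjWeight_add {K : Type*} [AddZeroClass K] (w w' : G.edgeSet → K) (v u : V) :
    G.adjWeight (w + w') v u = G.adjWeight w v u + G.adjWeight w' v u := by
  unfold adjWeight
  split_ifs <;> simp

lemma weightedLaplacian_add {K : Type*} [Ring K] [Fintype V] [DecidableEq V]
    (w w' : G.edgeSet → K) :
    G.weightedLaplacian (w + w') = G.weightedLaplacian w + G.weightedLaplacian w' := by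
  ext v u
  simp only [weightedLaplacian_apply, Matrix.add_apply, adjWeight_add, Finset.sum_add_distrib]
  split_ifs <;> abel

lemma weightedLaplacian_single {K : Type*} [Ring K] [Fintype V] [DecidableEq V]
    [DecidableEq G.edgeSet] {a b : V} (h : G.Adj a b) :
    G.weightedLaplacian (Pi.single (⟨s(a, b), h⟩ : G.edgeSet) (1 : K)) =
      vecMulVec (Pi.single a 1 - Pi.single b 1) (Pi.single a 1 - Pi.single b 1) := by
  have hab := h.ne
  have hw : ∀ v u, G.adjWeight (Pi.single (⟨s(a, b), h⟩ : G.edgeSet) (1 : K)) v u =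
      (if v = a then if u = b then 1 else 0 else 0) +
      (if v = b then if u = a then 1 else 0 else 0) := fun v u => by
    unfold adjWeight
    by_cases h1 : G.Adj v u
    · rw [dif_pos h1, Pi.single_apply]
      refine (if_congr (Subtype.ext_iff.trans Sym2.eq_iff) rfl rfl).trans ?_
      by_cases hva : v = a
      · subst hva
        simp [hab]
      · simp only [hva, false_and, false_or, if_false, zero_add, ite_and]
    · rw [dif_neg h1]
      have h2 : ¬ (v = a ∧ u = b) := fun h2 => h1 (by rwa [h2.1, h2.2])
      have h3 : ¬ (v = b ∧ u = a) := fun h3 => h1 (by rw [h3.1, h3.2]; exact h.symm)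
      simp only [← ite_and, if_neg h2, if_neg h3, add_zero]
  ext v u
  have hdiag : ∑ x, ((if v = a then if x = b then (1 : K) else 0 else 0) +
      (if v = b then if x = a then 1 else 0 else 0)) =
      (if v = a then 1 else 0) + (if v = b then 1 else 0) := by
    rw [Finset.sum_add_distrib]
    split_ifs <;> simp
  simp only [weightedLaplacian_apply, hw, vecMulVec_apply, hdiag, Pi.sub_apply, Pi.single_apply]
  by_cases hva : v = a
  · subst hva
    simp only [if_true, hab, if_false, add_zero, sub_zero, one_mul, eq_comm]
  · by_cases hvb : v = b
    · subst hvb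
      simp only [if_true, hva, if_false, zero_add, zero_sub, neg_mul, one_mul, neg_sub, eq_comm]
    · simp [hva, hvb]

/-- The entries of the Hessian matrix at the all-ones point in terms of the transfer currents. -/
theorem card_sq_mul_hessianMatrixAtOne {K : Type*} [Field K] [Fintype V] [DecidableEq V]
    [Nonempty V] [Fintype G.edgeSet] {A : Matrix V V K}
    (hAL : A = G.weightedLaplacian 1 + Matrix.of fun _ _ => 1) (hA : IsUnit A.det)
    {a b a' b' : V} (h : G.Adj a b) (h' : G.Adj a' b') (hne : s(a, b) ≠ s(a', b'))
    {x y : V → K} (hx : x = Pi.single a 1 - Pi.single b 1)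
    (hy : y = Pi.single a' 1 - Pi.single b' 1) :
    (Fintype.card V : K) ^ 2 * G.hessianMatrixAtOne K ⟨s(a, b), h⟩ ⟨s(a', b'), h'⟩ =
      A.det * ((x ⬝ᵥ A⁻¹ *ᵥ x) * (y ⬝ᵥ A⁻¹ *ᵥ y) - (x ⬝ᵥ A⁻¹ *ᵥ y) * (y ⬝ᵥ A⁻¹ *ᵥ x)) := by
  classical
  rw [hessianMatrixAtOne_of_ne fun h => hne (congrArg Subtype.val h), mul_add, mul_sub, mul_sub]
  simp only [← det_weightedLaplacian_add_one, weightedLaplacian_add, weightedLaplacian_single,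
    ← hx, ← hy]
  have e0 := det_add_vecMulVec_add_vecMulVec hA x y
  -- Taking the second vector to be 0 gives the one-edge update.
  have e1 := det_add_vecMulVec_add_vecMulVec hA x 0
  have e2 := det_add_vecMulVec_add_vecMulVec hA y 0
  simp only [vecMulVec_zero, add_zero, Matrix.mulVec_zero, dotProduct_zero, zero_dotProduct,
    mul_one, mul_zero, sub_zero] at e1 e2
  have c0 : G.weightedLaplacian 1 + vecMulVec x x + vecMulVec y y + Matrix.of (fun _ _ => 1) =
      A + vecMulVec x x + vecMulVec y y := by rw [hAL]; abel
  have c1 : ∀ z : V → K, G.weightedLaplacian 1 + vecMulVec z z + Matrix.of (fun _ _ => 1) =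
      A + vecMulVec z z := fun z => by rw [hAL]; abel
  rw [c0, c1, c1, e0, e1, e2, ← hAL]
  ring

end SimpleGraph

/-! ### The complete bipartite graph -/

lemma Matrix.smul_one_add_ones_mul_inverse {ι K : Type*} [Field K] [Fintype ι] [DecidableEq ι]
    {a : K} (ha : a ≠ 0) (h : a + Fintype.card ι ≠ 0) :
    (a • (1 : Matrix ι ι K) + (1 : K) • Matrix.of fun _ _ => 1) *
      (a⁻¹ • (1 : Matrix ι ι K) - (a * (a + Fintype.card ι))⁻¹ • Matrix.of fun _ _ => 1) = 1 := by
  set J : Matrix ι ι K := Matrix.of fun _ _ => 1 with hJ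
  have hJJ : J * J = (Fintype.card ι : K) • J := by
    ext i j
    simp [hJ, Matrix.mul_apply]
  have hc : a⁻¹ - a * (a * (a + Fintype.card ι))⁻¹ -
      (a * (a + Fintype.card ι))⁻¹ * Fintype.card ι = 0 := by
    field_simp
    ring
  have hexp : (a • (1 : Matrix ι ι K) + (1 : K) • J) *
      (a⁻¹ • (1 : Matrix ι ι K) - (a * (a + Fintype.card ι))⁻¹ • J) =
      (a * a⁻¹) • (1 : Matrix ι ι K) + (a⁻¹ - a * (a * (a + Fintype.card ι))⁻¹ -
      (a * (a + Fintype.card ι))⁻¹ * Fintype.card ι) • J := by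
    simp only [add_mul, mul_sub, smul_mul_smul_comm, one_mul, mul_one, hJJ, smul_smul]
    module
  rw [hexp, hc, mul_inv_cancel₀ ha, zero_smul, add_zero, one_smul]

namespace SimpleGraph

variable {α β : Type*}

/-- The edges of the complete bipartite graph are the pairs of vertices of the two parts. -/
noncomputable def completeBipartiteEdgeEquiv (α β : Type*) :
    α × β ≃ (completeBipartiteGraph α β).edgeSet :=
  Equiv.ofBijective (fun p => ⟨s(Sum.inl p.1, Sum.inr p.2), by simp [mem_edgeSet]⟩) <| by
    constructor
    · rintro ⟨i, j⟩ ⟨k, l⟩ h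
      simpa using congrArg Subtype.val h
    · rintro ⟨e, he⟩
      induction e using Sym2.ind with
      | _ u v =>
        rcases u with i | j <;> rcases v with k | l
        · simp [mem_edgeSet] at he
        · exact ⟨(i, l), rfl⟩
        · exact ⟨(k, j), Subtype.ext Sym2.eq_swap⟩
        · simp [mem_edgeSet] at he

variable {K : Type*} [Field K] [Fintype α] [DecidableEq α] [Fintype β] [DecidableEq β]

/-- The off-diagonal blocks of the Laplacian are −J, so adding the all-ones matrix cancels them. -/
lemma weightedLaplacian_completeBipartiteGraph_add_one :
    (completeBipartiteGraph α β).weightedLaplacian (1 : (completeBipartiteGraph α β).edgeSet → K) + Matrix.of (fun _ _ => 1) =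
      fromBlocks ((Fintype.card β : K) • (1 : Matrix α α K) + (1 : K) • Matrix.of fun _ _ => 1) 0 0
        ((Fintype.card α : K) • (1 : Matrix β β K) + (1 : K) • Matrix.of fun _ _ => 1) := by
  ext (i | j) (k | l) <;>
    simp [weightedLaplacian_apply, adjWeight, Matrix.one_apply, Fintype.sum_sum_type,
      -Finset.sum_boole]

/-- The entries of the Hessian matrix of the complete bipartite graph at the all-ones point. -/
lemma hessianMatrixAtOne_completeBipartiteGraph [CharZero K] [Nonempty α] [Nonempty β]
    [Fintype (completeBipartiteGraph α β).edgeSet] {m n : K} (hm : m = Fintype.card α)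
    (hn : n = Fintype.card β) (p q : α × β) :
    (completeBipartiteGraph α β).hessianMatrixAtOne K (completeBipartiteEdgeEquiv α β p)
      (completeBipartiteEdgeEquiv α β q) =
    n ^ (Fintype.card α - 1) * m ^ (Fintype.card β - 1) / (m * n) ^ 2 *
      ((if p = q then -2 * m * n else 0) + (if p.1 = q.1 then -(m ^ 2 - 2 * m) else 0) +
        (if p.2 = q.2 then -(n ^ 2 - 2 * n) else 0) + ((m + n) ^ 2 - 2 * (m + n))) := by
  -- On the diagonal the bracket sums to 0, matching the zero diagonal of the Hessian, so one
  -- formula covers all entries.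
  by_cases hpq : p = q
  · subst hpq
    rw [hessianMatrixAtOne_self]
    simp only [if_true]
    ring
  have hm0 : m ≠ 0 := hm ▸ Nat.cast_ne_zero.2 Fintype.card_ne_zero
  have hn0 : n ≠ 0 := hn ▸ Nat.cast_ne_zero.2 Fintype.card_ne_zero
  have hmn0 : m + n ≠ 0 := by
    rw [hm, hn, ← Nat.cast_add]
    exact Nat.cast_ne_zero.2 (Nat.add_pos_left Fintype.card_pos _).ne'
  have hnm0 : n + m ≠ 0 := add_comm m n ▸ hmn0
  have hA := weightedLaplacian_completeBipartiteGraph_add_one (K := K) (α := α) (β := β)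
  rw [← hm, ← hn] at hA
  set A := (completeBipartiteGraph α β).weightedLaplacian (1 : (completeBipartiteGraph α β).edgeSet → K) + Matrix.of (fun _ _ => 1)
    with hAL
  have hdet : A.det = n ^ (Fintype.card α - 1) * m ^ (Fintype.card β - 1) * (m + n) ^ 2 := by
    rw [hA, Matrix.det_fromBlocks_zero₂₁, det_smul_one_add_smul_ones hn0,
      det_smul_one_add_smul_ones hm0, ← hm, ← hn]
    ring
  have hu : IsUnit A.det := by
    rw [hdet]
    exact (mul_ne_zero (mul_ne_zero (pow_ne_zero _ hn0) (pow_ne_zero _ hm0))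
      (pow_ne_zero _ hmn0)).isUnit
  have hinv : A⁻¹ = fromBlocks
      (n⁻¹ • (1 : Matrix α α K) - (n * (n + m))⁻¹ • Matrix.of fun _ _ => 1) 0 0
      (m⁻¹ • (1 : Matrix β β K) - (m * (m + n))⁻¹ • Matrix.of fun _ _ => 1) := by
    refine Matrix.inv_eq_right_inv ?_
    rw [hA, fromBlocks_multiply]
    have h1 := smul_one_add_ones_mul_inverse (ι := α) hn0 (hm ▸ hnm0)
    have h2 := smul_one_add_ones_mul_inverse (ι := β) hm0 (hn ▸ hmn0)
    rw [← hm] at h1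
    rw [← hn] at h2
    simp only [Matrix.mul_zero, Matrix.zero_mul, add_zero, zero_add, h1, h2, fromBlocks_one]
  have hY : ∀ (i k : α) (j l : β),
      (Pi.single (Sum.inl i) 1 - Pi.single (Sum.inr j) 1 : α ⊕ β → K) ⬝ᵥ A⁻¹ *ᵥ
        (Pi.single (Sum.inl k) 1 - Pi.single (Sum.inr l) 1) =
      (if i = k then n⁻¹ else 0) + (if j = l then m⁻¹ else 0) - (m * n)⁻¹ := fun i k j l => by
    rw [Matrix.mulVec_sub, Matrix.mulVec_single_one, Matrix.mulVec_single_one, sub_dotProduct,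
      single_one_dotProduct, single_one_dotProduct, hinv]
    simp only [Pi.sub_apply, Matrix.col_apply, fromBlocks_apply₁₁, fromBlocks_apply₁₂,
      fromBlocks_apply₂₁, fromBlocks_apply₂₂, Matrix.sub_apply, Matrix.smul_apply,
      Matrix.one_apply, Matrix.of_apply, Matrix.zero_apply, smul_eq_mul, mul_one, mul_ite,
      mul_zero]
    have h : (n * (n + m))⁻¹ + (m * (m + n))⁻¹ = (m * n)⁻¹ := by
      field_simp
      ring
    linear_combination -h
  obtain ⟨i, j⟩ := p
  obtain ⟨k, l⟩ := q
  have hne : s((Sum.inl i : α ⊕ β), Sum.inr j) ≠ s(Sum.inl k, Sum.inr l) := by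
    simpa using hpq
  have h := card_sq_mul_hessianMatrixAtOne (K := K) hAL hu
    (by simp : (completeBipartiteGraph α β).Adj (Sum.inl i) (Sum.inr j))
    (by simp : (completeBipartiteGraph α β).Adj (Sum.inl k) (Sum.inr l)) hne rfl rfl
  simp only [hY, hdet, if_true, Fintype.card_sum, Nat.cast_add, ← hm, ← hn] at h
  refine mul_left_cancel₀ (pow_ne_zero 2 hmn0) (h.trans ?_)
  rw [if_neg hpq]
  rw [Prod.mk.injEq] at hpq
  generalize n ^ (Fintype.card α - 1) * m ^ (Fintype.card β - 1) = τ
  by_cases hik : i = k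
  · have hjl : j ≠ l := fun hjl => hpq ⟨hik, hjl⟩
    simp only [hik, hjl, hjl.symm, if_true, if_false]
    field_simp
    ring
  · by_cases hjl : j = l
    · simp only [hik, Ne.symm hik, hjl, if_true, if_false]
      field_simp
      ring
    · simp only [hik, Ne.symm hik, hjl, Ne.symm hjl, if_false]
      field_simp
      ring

/-- The determinant of the Hessian matrix of the complete bipartite graph at the all-ones point,
before simplification. -/
lemma det_hessianMatrixAtOne_completeBipartiteGraph [CharZero K] [Nonempty α] [Nonempty β]
    [Fintype (completeBipartiteGraph α β).edgeSet]
    [DecidableEq (completeBipartiteGraph α β).edgeSet] {m n : K} (hm : m = Fintype.card α)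
    (hn : n = Fintype.card β) :
    ((completeBipartiteGraph α β).hessianMatrixAtOne K).det =
      (n ^ (Fintype.card α - 1) * m ^ (Fintype.card β - 1) / (m * n) ^ 2) ^
        (Fintype.card α * Fintype.card β) *
      ((-2 * m * n) ^ ((Fintype.card α - 1) * (Fintype.card β - 1)) *
        (-m ^ 2 * n) ^ (Fintype.card α - 1) * (-n ^ 2 * m) ^ (Fintype.card β - 1) *
        (m * n * (m + n - 1) * (m + n - 2))) := by
  have hm0 : m ≠ 0 := hm ▸ Nat.cast_ne_zero.2 Fintype.card_ne_zero
  have hn0 : n ≠ 0 := hn ▸ Nat.cast_ne_zero.2 Fintype.card_ne_zero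
  -- The terms in 2mn cancel, so both mixed eigenvalues are monomials.
  have e1 : -2 * m * n + Fintype.card β * -(m ^ 2 - 2 * m) = -m ^ 2 * n := by
    rw [← hn]; ring
  have e2 : -2 * m * n + Fintype.card α * -(n ^ 2 - 2 * n) = -n ^ 2 * m := by
    rw [← hm]; ring
  have h := det_kronecker_one_ones (α := α) (β := β) (a := -2 * m * n) (b := -(m ^ 2 - 2 * m))
    (c := -(n ^ 2 - 2 * n)) (d := (m + n) ^ 2 - 2 * (m + n)) (by simp [hm0, hn0])
    (by rw [e1]; simp [hm0, hn0]) (by rw [e2]; simp [hm0, hn0])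
  rw [e1, e2] at h
  rw [← Matrix.det_submatrix_equiv_self (completeBipartiteEdgeEquiv α β)]
  have hH : ((completeBipartiteGraph α β).hessianMatrixAtOne K).submatrix
      (completeBipartiteEdgeEquiv α β) (completeBipartiteEdgeEquiv α β) =
      (n ^ (Fintype.card α - 1) * m ^ (Fintype.card β - 1) / (m * n) ^ 2) •
      (Matrix.of fun p q : α × β => (if p = q then -2 * m * n else 0) +
        (if p.1 = q.1 then -(m ^ 2 - 2 * m) else 0) +
        (if p.2 = q.2 then -(n ^ 2 - 2 * n) else 0) + ((m + n) ^ 2 - 2 * (m + n))) := by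
    ext p q
    exact hessianMatrixAtOne_completeBipartiteGraph hm hn p q
  rw [hH, Matrix.det_smul, h, Fintype.card_prod, ← hm, ← hn]
  ring

end SimpleGraph

/-! ### Closed formula and nonvanishing -/

theorem mainTheorem4 (K : Type*) [Field K] [CharZero K] (m n : ℕ) (hm : 1 ≤ m) (hn : 1 ≤ n)
    (hmn : 3 ≤ m + n) [Fintype (completeBipartiteGraph (Fin m) (Fin n)).edgeSet] :
    ((completeBipartiteGraph (Fin m) (Fin n)).hessianMatrixAtOne K).det =
        (-1 : K) ^ (m * n - 1) * (2 : K) ^ ((m - 1) * (n - 1)) *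
          (m : K) ^ (((m : ℤ) * n - m) * (n - 1) - 1) *
          (n : K) ^ (((m : ℤ) * n - n) * (m - 1) - 1) *
          ((m : K) + n - 1) * ((m : K) + n - 2) ∧
      ((completeBipartiteGraph (Fin m) (Fin n)).hessianMatrix K).det ≠ 0 := by
  have : Nonempty (Fin m) := ⟨⟨0, hm⟩⟩
  have : Nonempty (Fin n) := ⟨⟨0, hn⟩⟩
  have hm0 : (m : K) ≠ 0 := Nat.cast_ne_zero.2 (by omega)
  have hn0 : (n : K) ≠ 0 := Nat.cast_ne_zero.2 (by omega)
  have key : ((completeBipartiteGraph (Fin m) (Fin n)).hessianMatrixAtOne K).det =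
        (-1 : K) ^ (m * n - 1) * (2 : K) ^ ((m - 1) * (n - 1)) *
          (m : K) ^ (((m : ℤ) * n - m) * (n - 1) - 1) *
          (n : K) ^ (((m : ℤ) * n - n) * (m - 1) - 1) *
          ((m : K) + n - 1) * ((m : K) + n - 2) := by
    rw [SimpleGraph.det_hessianMatrixAtOne_completeBipartiteGraph (m := (m : K)) (n := (n : K))
      (by simp) (by simp), Fintype.card_fin, Fintype.card_fin]
    generalize (m : K) + n - 1 = c₁
    generalize (m : K) + n - 2 = c₂
    obtain ⟨M, rfl⟩ : ∃ M, m = M + 1 := ⟨m - 1, by omega⟩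
    obtain ⟨N, rfl⟩ : ∃ N, n = N + 1 := ⟨n - 1, by omega⟩
    -- The integer exponent is −1 when n = 1. It is split as a quotient of natural powers whose
    -- denominator is the one coming from (mn)² raised to the power mn.
    have hx : ((M + 1 : ℕ) : K) ^ ((((M + 1 : ℕ) : ℤ) * (N + 1 : ℕ) - (M + 1 : ℕ)) *
        (((N + 1 : ℕ) : ℤ) - 1) - 1) =
        ((M + 1 : ℕ) : K) ^ (N * ((M + 1) * (N + 1)) + M * N + 2 * M + N + 1) /
          ((M + 1 : ℕ) : K) ^ (2 * ((M + 1) * (N + 1))) := by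
      rw [← zpow_natCast, ← zpow_natCast, ← zpow_sub₀ hm0]
      congr 1
      push_cast
      ring
    have hy : ((N + 1 : ℕ) : K) ^ ((((M + 1 : ℕ) : ℤ) * (N + 1 : ℕ) - (N + 1 : ℕ)) *
        (((M + 1 : ℕ) : ℤ) - 1) - 1) =
        ((N + 1 : ℕ) : K) ^ (M * ((M + 1) * (N + 1)) + M * N + 2 * N + M + 1) /
          ((N + 1 : ℕ) : K) ^ (2 * ((M + 1) * (N + 1))) := by
      rw [← zpow_natCast, ← zpow_natCast, ← zpow_sub₀ hn0]
      congr 1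
      push_cast
      ring
    have hexp : (M + 1) * (N + 1) - 1 = M * N + M + N := by
      have : (M + 1) * (N + 1) = M * N + M + N + 1 := by ring
      omega
    have hneg : ∀ x : K, -x = -1 * x := fun x => (neg_one_mul x).symm
    rw [hx, hy, hexp]
    simp only [Nat.add_sub_cancel]
    generalize (M + 1) * (N + 1) = k
    generalize ((M + 1 : ℕ) : K) = x at *
    generalize ((N + 1 : ℕ) : K) = y at *
    rw [hneg (2 : K), hneg (x ^ 2), hneg (y ^ 2)]
    simp only [mul_pow, div_pow, ← pow_mul, pow_add, pow_one, div_mul_eq_mul_div,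
      mul_div_assoc']
    rw [mul_comm M k, mul_comm N k]
    field_simp
  refine ⟨key, fun h0 => ?_⟩
  have h : ((completeBipartiteGraph (Fin m) (Fin n)).hessianMatrixAtOne K).det = 0 := by
    -- Evaluation at the all-ones point commutes with the determinant, so a zero Hessian polynomial
    -- would force the value to vanish.
    have hmap := RingHom.map_det (MvPolynomial.eval fun _ => (1 : K))
      ((completeBipartiteGraph (Fin m) (Fin n)).hessianMatrix K)
    rw [h0, map_zero] at hmap
    exact hmap.symm
  have c1 : (m : K) + n - 1 ≠ 0 := by
    rw [sub_ne_zero]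
    exact_mod_cast (by omega : m + n ≠ 1)
  have c2 : (m : K) + n - 2 ≠ 0 := by
    rw [sub_ne_zero]
    exact_mod_cast (by omega : m + n ≠ 2)
  rw [key] at h
  exact mul_ne_zero (mul_ne_zero (mul_ne_zero (mul_ne_zero (mul_ne_zero
    (pow_ne_zero _ (by norm_num)) (pow_ne_zero _ two_ne_zero)) (zpow_ne_zero _ hm0))
    (zpow_ne_zero _ hn0)) c1) c2 h
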